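/- Let $\boldsymbol a=(a_0,a_1,\dots)$ be a sequence of integers all greater than $1$, let $\Delta_{\boldsymbol a}$ be the group of $\boldsymbol a$-adic integers, and let $\Sigma_{\boldsymbol a}=(\mathbb R\times\Delta_{\boldsymbol a})/B$, with $B=\{(n,n\mathbf u):n\in\mathbb Z\}$ and $\mathbf u=(1,0,0,\dots)$, be the $\boldsymbol a$-adic solenoid. Its character group is identified with the discrete group $H_{\boldsymbol a}=\{m/(a_0a_1\cdots a_n): n=0,1,\dots;\ m\in\mathbb Z\}\subset\mathbb R$, and $(g,r)$ denotes the value of the character $r\in H_{\boldsymbol a}$ at $g\in\Sigma_{\boldsymbol a}$. Let $\mathbb T$ be the circle group of complex numbers of modulus $1$ and let $X=\Sigma_{\boldsymbol a}\times\mathbb T$ (with the group operation of $X$ written additively). Suppose that $\Sigma_{\boldsymbol a}$ contains no element of order $2$ (so that division by $2$ in $H_{\boldsymbol a}$ is possible). Let $G$ be the subgroup of $X$ generated by the element of order $2$. Let $b\in H_{\boldsymbol a}$ and let $\alpha$ be the topological automorphism of $X$ with matrix $\begin{pmatrix}-1&b\\0&1\end{pmatrix}$, that is, $\alpha(g,z)=(-g,(g,b)z)$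 for $g\in\Sigma_{\boldsymbol a}$, $z\in\mathbb T$. Let $$K=\left\{\left(g,\pm\left(-g,\tfrac b2\right)\right): g\in\Sigma_{\boldsymbol a}\right\},$$ a subgroup of $X$. Let $\xi_1,\xi_2$ be independent random variables with values in $X$ and distributions $\mu_1,\mu_2$, and assume that the conditional distribution of $L_2=\xi_1+\alpha\xi_2$ given $L_1=\xi_1+\xi_2$ is symmetric. Then there are elements $x_1,x_2\in X$ and probability distributions $\lambda_1,\lambda_2$ on $X$ concentrated at $K$ such that $\mu_j=\lambda_j*E_{x_j}$ for $j=1,2$, where $E_x$ is the degenerate distribution at $x$; moreover, either $\lambda_2=\lambda_1*\omega_1$ or $\lambda_1=\lambda_2*\omega_2$ for some probability distribution $\omega_j$ on $X$ concentrated at $G$. -/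

import Mathlib

open MeasureTheory ProbabilityTheory

noncomputable section

namespace Heyde

/-- The product `a₀ a₁ ⋯ aₙ`. -/
def prodA (a : ℕ → ℕ) (n : ℕ) : ℕ := ∏ i ∈ Finset.range (n + 1), a i

theorem prodA_succ (a : ℕ → ℕ) (n : ℕ) : prodA a (n + 1) = prodA a n * a (n + 1) :=
  Finset.prod_range_succ _ _

theorem prodA_dvd (a : ℕ → ℕ) {n k : ℕ} (h : n ≤ k) : prodA a n ∣ prodA a k :=
  Finset.prod_dvd_prod_of_subset _ _ _ (by simpa using h)

instance prodA_neZero (a : ℕ → ℕ) [∀ i, (a i).AtLeastTwo] (n : ℕ) : NeZero (prodA a n) :=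
  ⟨Finset.prod_ne_zero_iff.2 fun i _ => by
    have := Nat.AtLeastTwo.prop (n := a i); omega⟩

/-- The group `Δ_a` of `a`-adic integers, as the inverse limit of the groups `ℤ / a₀ a₁ ⋯ aₙ`.
The sequence of digits `(x₀, x₁, …)`, `0 ≤ xᵢ < aᵢ`, corresponds to the compatible family
whose `n`-th member is `x₀ + x₁ a₀ + ⋯ + xₙ a₀ ⋯ aₙ₋₁`; addition with carry is addition of
compatible families, and the topology is that of the product of the discrete factors. -/
def AdicInt (a : ℕ → ℕ) : AddSubgroup (∀ n, ZMod (prodA a n)) where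
  carrier := {x | ∀ n, ZMod.castHom (prodA_dvd a n.le_succ) (ZMod (prodA a n)) (x (n + 1)) = x n}
  zero_mem' := fun n => by simp
  add_mem' := fun {x y} hx hy n => by
    simp only [Pi.add_apply, map_add]; rw [hx n, hy n]
  neg_mem' := fun {x} hx n => by
    simp only [Pi.neg_apply, map_neg]; rw [hx n]

/-- The element `𝐮 = (1, 0, 0, …)` of `Δ_a`. -/
def AdicInt.u (a : ℕ → ℕ) : AdicInt a := ⟨fun _ => 1, fun _ => map_one _⟩

/-- The subgroup `B = {(n, n𝐮) : n ∈ ℤ}` of `ℝ × Δ_a`. -/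
def subgroupB (a : ℕ → ℕ) : AddSubgroup (ℝ × AdicInt a) :=
  AddSubgroup.zmultiples ((1 : ℝ), AdicInt.u a)

/-- The `a`-adic solenoid `Σ_a = (ℝ × Δ_a) / B`. -/
def Solenoid (a : ℕ → ℕ) : Type := (ℝ × AdicInt a) ⧸ subgroupB a

namespace Solenoid

instance (a : ℕ → ℕ) : AddCommGroup (Solenoid a) :=
  inferInstanceAs (AddCommGroup ((ℝ × AdicInt a) ⧸ subgroupB a))

instance (a : ℕ → ℕ) : TopologicalSpace (Solenoid a) :=
  inferInstanceAs (TopologicalSpace ((ℝ × AdicInt a) ⧸ subgroupB a))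

instance (a : ℕ → ℕ) : IsTopologicalAddGroup (Solenoid a) :=
  inferInstanceAs (IsTopologicalAddGroup ((ℝ × AdicInt a) ⧸ subgroupB a))

instance (a : ℕ → ℕ) : MeasurableSpace (Solenoid a) := borel _

instance (a : ℕ → ℕ) : BorelSpace (Solenoid a) := ⟨rfl⟩

instance (a : ℕ → ℕ) : SecondCountableTopology (Solenoid a) := by
  have h : SecondCountableTopology (AdicInt a) := by
    have : ∀ n, Countable (ZMod (prodA a n)) := fun n =>
      Function.Surjective.countable (f := ((↑) : ℤ → ZMod (prodA a n))) ZMod.intCast_surjective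
    have : SecondCountableTopology (∀ n, ZMod (prodA a n)) := inferInstance
    exact TopologicalSpace.Subtype.secondCountableTopology _
  exact QuotientAddGroup.instSecondCountableTopology (N := subgroupB a)

/-- The quotient map `ℝ × Δ_a → Σ_a`. -/
def mk (a : ℕ → ℕ) : ℝ × AdicInt a →+ Solenoid a := QuotientAddGroup.mk' (subgroupB a)

theorem mk_surjective (a : ℕ → ℕ) : Function.Surjective (mk a) :=
  QuotientAddGroup.mk'_surjective _

theorem continuous_mk (a : ℕ → ℕ) : Continuous (mk a) := QuotientAddGroup.continuous_mk

theorem mk_eq_zero_iff (a : ℕ → ℕ) (p : ℝ × AdicInt a) :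
    mk a p = 0 ↔ ∃ n : ℤ, (n : ℝ) = p.1 ∧ n • AdicInt.u a = p.2 := by
  refine (QuotientAddGroup.eq_zero_iff p).trans ?_
  rw [subgroupB, AddSubgroup.mem_zmultiples_iff]
  refine exists_congr fun n => ?_
  rw [Prod.ext_iff]
  simp

theorem isClosed_subgroupB (a : ℕ → ℕ) : IsClosed (subgroupB a : Set (ℝ × AdicInt a)) := by
  have h0 : IsProperMap (Prod.fst ∘ fun n : ℤ => n • ((1 : ℝ), AdicInt.u a)) := by
    convert Int.isClosedEmbedding_coe_real.isProperMap using 1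
    funext n
    simp
  have h1 := isProperMap_of_comp_of_t2 continuous_of_discreteTopology continuous_fst h0
  have h2 : (subgroupB a : Set (ℝ × AdicInt a)) =
      Set.range fun n : ℤ => n • ((1 : ℝ), AdicInt.u a) := by
    ext p
    simp [subgroupB, AddSubgroup.mem_zmultiples_iff]
  rw [h2]
  exact h1.isClosedMap.isClosed_range

instance (a : ℕ → ℕ) : T3Space (Solenoid a) :=
  haveI := isClosed_subgroupB a
  inferInstanceAs (T3Space ((ℝ × AdicInt a) ⧸ subgroupB a))

theorem isClosed_adicInt (a : ℕ → ℕ) : IsClosed (AdicInt a : Set (∀ n, ZMod (prodA a n))) := by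
  have : (AdicInt a : Set (∀ n, ZMod (prodA a n))) =
      ⋂ n, {x | ZMod.castHom (prodA_dvd a n.le_succ) (ZMod (prodA a n)) (x (n + 1)) = x n} := by
    ext x; simp [AdicInt]
  rw [this]
  refine isClosed_iInter fun n => isClosed_eq ?_ (continuous_apply n)
  exact continuous_of_discreteTopology.comp (continuous_apply (n + 1))

instance (a : ℕ → ℕ) [∀ i, (a i).AtLeastTwo] : CompactSpace (AdicInt a) :=
  isCompact_iff_compactSpace.1 (isClosed_adicInt a).isCompact

instance (a : ℕ → ℕ) [∀ i, (a i).AtLeastTwo] : CompactSpace (Solenoid a) := by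
  have hc : IsCompact (mk a '' (Set.Icc (0 : ℝ) 1 ×ˢ (Set.univ : Set (AdicInt a)))) :=
    (isCompact_Icc.prod isCompact_univ).image (continuous_mk a)
  refine ⟨hc.of_isClosed_subset isClosed_univ fun g _ => ?_⟩
  obtain ⟨p, rfl⟩ := mk_surjective a g
  refine ⟨p - ⌊p.1⌋ • ((1 : ℝ), AdicInt.u a), ⟨?_, Set.mem_univ _⟩, ?_⟩
  · simp only [Prod.fst_sub, Prod.smul_fst, zsmul_eq_mul, mul_one]
    exact ⟨by linarith [Int.floor_le p.1], by linarith [Int.lt_floor_add_one p.1]⟩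
  · rw [map_sub, sub_eq_self, mk_eq_zero_iff]
    exact ⟨⌊p.1⌋, by simp, by simp⟩

instance (a : ℕ → ℕ) [∀ i, (a i).AtLeastTwo] : PolishSpace (Solenoid a) := by
  let := TopologicalSpace.metrizableSpaceMetric (Solenoid a)
  infer_instance

end Solenoid

/-- The group `H_a = {m / (a₀ a₁ ⋯ aₙ) : n = 0, 1, …; m ∈ ℤ}`, a subgroup of `ℝ`. -/
def groupH (a : ℕ → ℕ) [∀ i, (a i).AtLeastTwo] : AddSubgroup ℝ where
  carrier := {r | ∃ (n : ℕ) (m : ℤ), r = m / prodA a n}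
  zero_mem' := ⟨0, 0, by simp⟩
  add_mem' := by
    rintro _ _ ⟨n, m, rfl⟩ ⟨n', m', rfl⟩
    obtain ⟨c, hc⟩ := prodA_dvd a (le_max_left n n')
    obtain ⟨c', hc'⟩ := prodA_dvd a (le_max_right n n')
    refine ⟨max n n', m * c + m' * c', ?_⟩
    have h0 : (prodA a (max n n') : ℝ) ≠ 0 := Nat.cast_ne_zero.2 (NeZero.ne _)
    have h1 : (prodA a n : ℝ) ≠ 0 := Nat.cast_ne_zero.2 (NeZero.ne _)
    have h2 : (prodA a n' : ℝ) ≠ 0 := Nat.cast_ne_zero.2 (NeZero.ne _)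
    have e1 : (prodA a (max n n') : ℝ) = prodA a n * c := by exact_mod_cast hc
    have e2 : (prodA a (max n n') : ℝ) = prodA a n' * c' := by exact_mod_cast hc'
    have e3 : (m : ℝ) / prodA a n = m * c / prodA a (max n n') := by
      rw [div_eq_div_iff h1 h0, e1]; ring
    have e4 : (m' : ℝ) / prodA a n' = m' * c' / prodA a (max n n') := by
      rw [div_eq_div_iff h2 h0, e2]; ring
    rw [e3, e4]
    push_cast
    ring
  neg_mem' := by
    rintro _ ⟨n, m, rfl⟩
    exact ⟨n, -m, by push_cast; ring⟩

/-- The circle group `𝕋`, written additively: the complex numbers of modulus `1`,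
with `+` denoting the multiplication of complex numbers. -/
abbrev Torus : Type := Additive Circle

instance : MeasurableSpace Torus := borel _

instance : BorelSpace Torus := ⟨rfl⟩

namespace Solenoid

theorem exists_int_rep (a : ℕ → ℕ) (x : AdicInt a) (k : ℕ) :
    ∃ j : ℤ, ∀ n ≤ k, (j : ZMod (prodA a n)) = x.1 n := by
  obtain ⟨j, hj⟩ := ZMod.intCast_surjective (x.1 k)
  refine ⟨j, fun n hn => ?_⟩
  induction hn using Nat.decreasingInduction with
  | self => exact hj
  | of_succ i _ ih => rw [← x.2 i, ← ih, map_intCast]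

variable (a : ℕ → ℕ) [∀ i, (a i).AtLeastTwo]

/-- The homomorphism `(t, x) ↦ exp (2πi (m / (a₀ ⋯ aₙ)) (t - xₙ))` from `ℝ × Δ_a` to `𝕋`,
where `xₙ ∈ ℤ / a₀ ⋯ aₙ` is the `n`-th member of `x`. -/
def preChar (n : ℕ) (m : ℤ) : ℝ × AdicInt a →+ Torus where
  toFun p := Additive.ofMul (Circle.exp (2 * Real.pi * (m / prodA a n) * p.1) *
    (ZMod.toCircle ((m : ZMod (prodA a n)) * p.2.1 n))⁻¹)
  map_zero' := by simp
  map_add' p q := by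
    rw [← ofMul_mul]
    congr 1
    simp only [Prod.fst_add, Prod.snd_add, AddSubgroup.coe_add, Pi.add_apply, mul_add,
      Circle.exp_add, AddChar.map_add_eq_mul, mul_inv]
    exact mul_mul_mul_comm _ _ _ _

theorem continuous_preChar (n : ℕ) (m : ℤ) : Continuous (preChar a n m) := by
  have h1 : Continuous fun p : ℝ × AdicInt a =>
      Circle.exp (2 * Real.pi * (m / prodA a n) * p.1) :=
    Circle.exp.continuous.comp (continuous_const.mul continuous_fst)
  have h2 : Continuous fun p : ℝ × AdicInt a =>
      (ZMod.toCircle ((m : ZMod (prodA a n)) * p.2.1 n))⁻¹ := by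
    have h3 : Continuous fun z : ZMod (prodA a n) =>
      (ZMod.toCircle ((m : ZMod (prodA a n)) * z))⁻¹ := continuous_of_discreteTopology
    exact h3.comp ((continuous_apply n).comp (continuous_subtype_val.comp continuous_snd))
  exact continuous_ofMul.comp (h1.mul h2)

/-- If the integer `j` represents `xₙ`, then the value is `exp (2πi (m / (a₀ ⋯ aₙ)) (t - j))`. -/
theorem preChar_apply (n : ℕ) (m : ℤ) (t : ℝ) (x : AdicInt a) (j : ℤ)
    (hj : (j : ZMod (prodA a n)) = x.1 n) :
    preChar a n m (t, x) =
      Additive.ofMul (Circle.exp (2 * Real.pi * ((m / prodA a n) * (t - j)))) := by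
  change Additive.ofMul _ = _
  congr 1
  have h : ZMod.toCircle ((m : ZMod (prodA a n)) * x.1 n) =
      Circle.exp (2 * Real.pi * ((m / prodA a n) * j)) := by
    rw [← hj, ← Int.cast_mul, Circle.ext_iff, ZMod.toCircle_intCast, Circle.coe_exp]
    congr 1
    push_cast
    ring
  dsimp only
  rw [h, ← Circle.exp_neg, ← Circle.exp_add]
  congr 1
  ring

/-- `preChar a n m` depends only on the number `m / (a₀ ⋯ aₙ)`. -/
theorem preChar_congr {n n' : ℕ} {m m' : ℤ} (h : (m : ℝ) / prodA a n = m' / prodA a n') :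
    preChar a n m = preChar a n' m' := by
  ext ⟨t, x⟩
  obtain ⟨j, hj⟩ := exists_int_rep a x (max n n')
  rw [preChar_apply a n m t x j (hj n (le_max_left _ _)),
    preChar_apply a n' m' t x j (hj n' (le_max_right _ _)), h]

theorem subgroupB_le_ker (n : ℕ) (m : ℤ) : subgroupB a ≤ (preChar a n m).ker := by
  rw [subgroupB, AddSubgroup.zmultiples_le, AddMonoidHom.mem_ker,
    preChar_apply a n m 1 (AdicInt.u a) 1 (by simp [AdicInt.u])]
  simp

variable {a}

/-- The character `g ↦ (g, r)` of `Σ_a` given by `r ∈ H_a`: for `r = m / (a₀ ⋯ aₙ)` its value at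
the class of `(t, x)` is `exp (2πi r (t - xₙ))`. -/
def char (r : groupH a) : Solenoid a →ₜ+ Torus where
  toAddMonoidHom := QuotientAddGroup.lift (subgroupB a)
    (preChar a r.2.choose r.2.choose_spec.choose) (subgroupB_le_ker a _ _)
  continuous_toFun := Continuous.quotient_lift (continuous_preChar a _ _) _

theorem char_mk (r : groupH a) (n : ℕ) (m : ℤ) (hr : (r : ℝ) = m / prodA a n)
    (p : ℝ × AdicInt a) : char r (mk a p) = preChar a n m p := by
  rw [preChar_congr a (hr.symm.trans r.2.choose_spec.choose_spec)]
  rfl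

theorem exists_even (h : ∀ g : Solenoid a, addOrderOf g ≠ 2) (N : ℕ) : ∃ i ≥ N, Even (a i) := by
  by_contra! hc
  simp only [Nat.not_even_iff_odd] at hc
  set D : ℕ := ∏ i ∈ Finset.range N, a i with hD
  have hD0 : D ≠ 0 := Finset.prod_ne_zero_iff.2 fun i _ => by
    have := Nat.AtLeastTwo.prop (n := a i); omega
  set O : ℕ → ℕ := fun n => ∏ i ∈ Finset.Ico N (n + 1), a i with hO
  have hodd : ∀ n, Odd (O n) := fun n =>
    Finset.prod_induction _ Odd (fun _ _ => Odd.mul) odd_one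
      fun i hi => hc i (Finset.mem_Ico.1 hi).1
  have hq : ∀ n, O n = 2 * (O n / 2) + 1 := fun n => (Nat.two_mul_div_two_add_one_of_odd (hodd n)).symm
  have hA : ∀ n, N ≤ n + 1 → prodA a n = D * O n := fun n hn =>
    (Finset.prod_range_mul_prod_Ico _ hn).symm
  have hAd : ∀ n, prodA a n ∣ D * O n := fun n => by
    rcases le_total N (n + 1) with hn | hn
    · rw [hA n hn]
    · exact (Finset.prod_dvd_prod_of_subset _ _ _ (by simpa using hn)).mul_right _
  let x : AdicInt a := ⟨fun n => ((-(D * (O n / 2 : ℕ)) : ℤ) : ZMod (prodA a n)), fun n => by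
    rw [map_intCast, ← sub_eq_zero, ← Int.cast_sub, ZMod.intCast_zmod_eq_zero_iff_dvd]
    rcases le_or_gt N (n + 1) with hn | hn
    · have h1 : O (n + 1) = O n * a (n + 1) := Finset.prod_Ico_succ_top hn _
      obtain ⟨k, hk⟩ := hc (n + 1) hn
      refine ⟨-k, ?_⟩
      rw [hA n hn]
      have h2 := hq (n + 1)
      have h3 := hq n
      generalize O n / 2 = q at *
      generalize O (n + 1) / 2 = q' at *
      have h4 : (q' : ℤ) = q + O n * k := by
        rw [hk] at h1
        zify at h1 h2 h3
        linarith
      rw [h4]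
      push_cast
      ring
    · have h1 : O (n + 1) = 1 := by
        simp only [hO]; rw [Finset.Ico_eq_empty (by omega), Finset.prod_empty]
      have h2 : O n = 1 := by
        simp only [hO]; rw [Finset.Ico_eq_empty (by omega), Finset.prod_empty]
      rw [h1, h2]
      simp⟩
  refine h (mk a ((D : ℝ) / 2, x)) (addOrderOf_eq_prime ?_ ?_)
  · rw [← map_nsmul, mk_eq_zero_iff]
    refine ⟨D, by simp; ring, ?_⟩
    ext n
    change (D : ℤ) • (1 : ZMod (prodA a n)) =
      2 • (((-(D * (O n / 2 : ℕ)) : ℤ)) : ZMod (prodA a n))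
    have h1 : ((D * O n : ℕ) : ZMod (prodA a n)) = 0 := (ZMod.natCast_eq_zero_iff _ _).2 (hAd n)
    rw [hq n] at h1
    generalize O n / 2 = q at *
    push_cast at h1 ⊢
    simp only [zsmul_eq_mul, nsmul_eq_mul]
    push_cast
    linear_combination h1
  · rw [Ne, mk_eq_zero_iff]
    rintro ⟨k, hk1, hk2⟩
    have h1 := congrFun (congrArg Subtype.val hk2) N
    change k • (1 : ZMod (prodA a N)) = (((-(D * (O N / 2 : ℕ)) : ℤ)) : ZMod (prodA a N)) at h1
    rw [zsmul_one, ← sub_eq_zero, ← Int.cast_sub, ZMod.intCast_zmod_eq_zero_iff_dvd,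
      hA N (by omega)] at h1
    obtain ⟨j, hj⟩ := h1
    have h2 : (2 : ℤ) * k = D := by
      have : (2 : ℝ) * k = D := by rw [hk1]; ring
      exact_mod_cast this
    have h3 := hq N
    have h4 : (D : ℤ) * O N * (2 * j - 1) = 0 := by
      push_cast at hj
      zify at h3
      linear_combination -2 * hj + h2 - D * h3
    have h5 : (O N : ℤ) ≠ 0 := by omega
    have h6 : (D : ℤ) ≠ 0 := by omega
    have h7 : 2 * j - 1 ≠ 0 := by omega
    exact mul_ne_zero (mul_ne_zero h6 h5) h7 h4

/-- If `Σ_a` has no element of order `2`, then division by `2` is possible in `H_a`. -/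
theorem half_mem (h : ∀ g : Solenoid a, addOrderOf g ≠ 2) (r : groupH a) :
    (r : ℝ) / 2 ∈ groupH a := by
  obtain ⟨r, n, m, rfl⟩ := r
  obtain ⟨i, hi, e, he⟩ := exists_even h (n + 1)
  obtain ⟨k, rfl⟩ : ∃ k, i = k + 1 := ⟨i - 1, by omega⟩
  obtain ⟨c, hc⟩ := prodA_dvd a (show n ≤ k by omega)
  have h1 : prodA a (k + 1) = prodA a n * (2 * (c * e)) := by
    rw [prodA_succ, hc, he]; ring
  refine ⟨k + 1, m * (c * e : ℕ), ?_⟩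
  have h0 : (prodA a (k + 1) : ℝ) ≠ 0 := Nat.cast_ne_zero.2 (NeZero.ne _)
  have h2 : (prodA a n : ℝ) ≠ 0 := Nat.cast_ne_zero.2 (NeZero.ne _)
  change (m : ℝ) / prodA a n / 2 = _
  rw [div_div, div_eq_div_iff (mul_ne_zero h2 two_ne_zero) h0, h1]
  push_cast
  ring

/-- The element `b / 2` of `H_a`. -/
def half (h : ∀ g : Solenoid a, addOrderOf g ≠ 2) (b : groupH a) : groupH a :=
  ⟨(b : ℝ) / 2, half_mem h b⟩

end Solenoid

section Automorphism

variable {a : ℕ → ℕ} [∀ i, (a i).AtLeastTwo]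

/-- The topological automorphism of `Σ_a × 𝕋` with matrix `[[-1, b], [0, 1]]`, that is
`(g, z) ↦ (-g, (g, b) z)`. -/
def alpha (b : groupH a) : (Solenoid a × Torus) ≃ₜ+ (Solenoid a × Torus) where
  toFun x := (-x.1, Solenoid.char b x.1 + x.2)
  invFun x := (-x.1, Solenoid.char b x.1 + x.2)
  left_inv x := by simp
  right_inv x := by simp
  map_add' x y := by
    ext1
    · simp [add_comm]
    · simp only [Prod.fst_add, Prod.snd_add, map_add]
      exact add_add_add_comm _ _ _ _
  continuous_toFun := by
    have := (Solenoid.char b).continuous_toFun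
    exact (continuous_fst.neg).prodMk ((this.comp continuous_fst).add continuous_snd)
  continuous_invFun := by
    have := (Solenoid.char b).continuous_toFun
    exact (continuous_fst.neg).prodMk ((this.comp continuous_fst).add continuous_snd)

theorem inv_neg_circle (z : Circle) : (-z)⁻¹ = -z⁻¹ := by
  rw [inv_eq_iff_mul_eq_one, neg_mul_neg, mul_inv_cancel]

/-- The subgroup `{(g, ±(-g, c)) : g ∈ Σ_a}` of `Σ_a × 𝕋`, where `c ∈ H_a` and `±` is the sign
of complex numbers. -/
def subgroupK (c : groupH a) : AddSubgroup (Solenoid a × Torus) where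
  carrier := {x | ∃ g : Solenoid a,
    x = (g, Solenoid.char c (-g)) ∨ x = (g, Additive.ofMul (-(Solenoid.char c (-g)).toMul))}
  zero_mem' := ⟨0, Or.inl (by ext1 <;> simp)⟩
  add_mem' := by
    rintro _ _ ⟨g, rfl | rfl⟩ ⟨g', rfl | rfl⟩ <;> refine ⟨g + g', ?_⟩
    · exact Or.inl (by ext1 <;> simp [add_comm])
    · refine Or.inr ?_
      ext1
      · rfl
      · rw [Prod.snd_add, neg_add, map_add, toMul_add, ← mul_neg, ofMul_mul, ofMul_toMul]
    · refine Or.inr ?_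
      ext1
      · rfl
      · rw [Prod.snd_add, neg_add, map_add, toMul_add, ← neg_mul, ofMul_mul, ofMul_toMul]
    · refine Or.inl ?_
      ext1
      · rfl
      · rw [Prod.snd_add, neg_add, map_add, ← ofMul_mul, neg_mul_neg, ofMul_mul, ofMul_toMul,
          ofMul_toMul]
  neg_mem' := by
    rintro _ ⟨g, rfl | rfl⟩ <;> refine ⟨-g, ?_⟩
    · exact Or.inl (by ext1 <;> simp)
    · refine Or.inr ?_
      ext1
      · rfl
      · rw [Prod.snd_neg, ← ofMul_inv, inv_neg_circle, ← toMul_neg, ← map_neg]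

end Automorphism

/-- The subgroup generated by the elements of order `2`. -/
def subgroupG (X : Type*) [AddGroup X] : AddSubgroup X :=
  AddSubgroup.closure {x | addOrderOf x = 2}

/-- The probability distributions on `X` that are concentrated at `S`. -/
def distributionsOn {X : Type*} [MeasurableSpace X] (S : Set X) : Set (Measure X) :=
  {μ | IsProbabilityMeasure μ ∧ μ Sᶜ = 0}

/-- The conditional distribution of `L₂` given `L₁` is symmetric: for almost every value `x` of
`L₁`, it is invariant under `y ↦ -y`. -/
def CondSymmetric {Ω X : Type*} [MeasurableSpace Ω] [AddCommGroup X] [MeasurableSpace X]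
    [StandardBorelSpace X] [MeasurableNeg X] (P : Measure Ω) [IsProbabilityMeasure P] (L₂ L₁ : Ω → X) : Prop :=
  ∀ᵐ x ∂(P.map L₁), (condDistrib L₂ L₁ P x).map (fun y => -y) = condDistrib L₂ L₁ P x

end Heyde

end

open Heyde

open Heyde

namespace Heyde

/-! ### Symmetry of a joint law, degeneracy, proportionality -/

section General

/-! Let `c = b/2` and let `ψ(g, z) = (g, c) z` be `fiberChar c`. Since `2c = b`, `ψ` is invariant
under `α` (`fiberChar_alpha`), and `K` is the preimage of `{1, -1}` under `ψ` (`mem_subgroupK_iff`).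
The hypothesis says that `(L₁, L₂)` and `(L₁, -L₂)` have the same law, and it is used twice.

Along the fibre: `ψ(L₁) = ψ(L₂)` always, hence also `ψ(L₁) = -ψ(L₂)` almost surely, so `2ψ(ξ₁) +
2ψ(ξ₂) = 0`. By independence both terms are constant, and shifting `ξ₁`, `ξ₂` by opposite elements
of the circle puts them in `K` without changing `L₁` or `L₂`.

Along the base: the projections of `L₁`, `L₂` are the sum and the difference of the projections
`g₁`, `g₂`. Without elements of order 2 these determine `g₁` and `g₂`, so `(g₁, g₂, ψ(L₁))` and
`(g₂, g₁, ψ(L₁))` have the same law (`map_exchange`). Hence `g₁` and `g₂` are equidistributed. With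
`sⱼ = ±1` the sign of the `j`-th variable and `Nⱼ(A) = E[sⱼ; gⱼ ∈ A]`, independence also gives
`N₁(A) N₂(B) = N₁(B) N₂(A)`. So one `Nⱼ` is `t` times the other with `|t| ≤ 1`, and convolution with
a law on `{0, (0, -1)}` of mean sign `t` realises this factor (`exists_eq_conv`). -/

theorem CondSymmetric.map_prodMk_neg {Ω X : Type*} [MeasurableSpace Ω] [AddCommGroup X]
    [MeasurableSpace X] [StandardBorelSpace X] [MeasurableNeg X] {P : Measure Ω}
    [IsProbabilityMeasure P] {L₂ L₁ : Ω → X} (h₂ : Measurable L₂) (h₁ : Measurable L₁)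
    (h : CondSymmetric P L₂ L₁) :
    P.map (fun ω => (L₁ ω, -L₂ ω)) = P.map (fun ω => (L₁ ω, L₂ ω)) := by
  -- The joint law is the law of `L₁` composed with the conditional kernel, so almost everywhere
  -- invariance of the kernel passes to it.
  have h3 : P.map L₁ ⊗ₘ (condDistrib L₂ L₁ P).map (fun y => -y) =
      P.map L₁ ⊗ₘ condDistrib L₂ L₁ P := by
    refine Measure.compProd_congr ?_
    filter_upwards [h] with x hx
    rw [Kernel.map_apply _ measurable_neg]
    exact hx
  rw [Measure.compProd_map measurable_neg, compProd_map_condDistrib h₂.aemeasurable,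
    Measure.map_map (measurable_id.prodMap measurable_neg) (h₁.prodMk h₂)] at h3
  exact h3

/-- Two independent random variables whose sum vanishes almost surely are degenerate. -/
theorem exists_ae_eq_of_indepFun_of_add_eq_zero {Ω T : Type*} [MeasurableSpace Ω] [AddGroup T]
    [MeasurableSpace T] [MeasurableAdd₂ T] [MeasurableSingletonClass T] {P : Measure Ω}
    [IsProbabilityMeasure P] {X Y : Ω → T} (hX : Measurable X) (hY : Measurable Y)
    (hXY : IndepFun X Y P) (h : ∀ᵐ ω ∂P, X ω + Y ω = 0) :
    ∃ d, (∀ᵐ ω ∂P, X ω = d) ∧ ∀ᵐ ω ∂P, Y ω = -d := by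
  have hm : MeasurableSet {p : T × T | p.1 + p.2 = 0} :=
    measurable_add (MeasurableSet.singleton 0)
  have h1 : ∀ᵐ p ∂(P.map X).prod (P.map Y), p.1 + p.2 = 0 := by
    rw [← (indepFun_iff_map_prod_eq_prod_map_map hX.aemeasurable hY.aemeasurable).1 hXY]
    exact (ae_map_iff (hX.prodMk hY).aemeasurable hm).2 h
  have := Measure.isProbabilityMeasure_map (μ := P) hX.aemeasurable
  -- Fubini: a single value `d` of the first variable already forces the second to be `-d` almost
  -- surely.
  obtain ⟨d, hd⟩ := (Measure.ae_ae_of_ae_prod h1).exists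
  have h2 : ∀ᵐ ω ∂P, d + Y ω = 0 := ae_of_ae_map hY.aemeasurable hd
  refine ⟨d, ?_, ?_⟩
  · filter_upwards [h, h2] with ω h3 h4
    exact add_right_cancel (h3.trans h4.symm)
  · filter_upwards [h2] with ω h3
    exact (neg_eq_of_add_eq_zero_right h3).symm

/-- If `f i ≠ 0`, then `g` is `g i / f i` times `f`; either this ratio or its inverse has absolute
value at most `1`, which decides the alternative. -/
theorem exists_proportional {ι : Type*} (f g : ι → ℝ) (h : ∀ i j, f i * g j = f j * g i) :
    ∃ t : ℝ, |t| ≤ 1 ∧ ((∀ i, f i = t * g i) ∨ ∀ i, g i = t * f i) := by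
  by_cases hf : ∀ i, f i = 0
  · exact ⟨0, by simp, Or.inl fun i => by simp [hf i]⟩
  push Not at hf
  obtain ⟨i, hi⟩ := hf
  have hg : ∀ j, g j = g i / f i * f j := fun j => by
    field_simp
    linarith [h i j]
  rcases le_or_gt |g i / f i| 1 with hr | hr
  · exact ⟨_, hr, Or.inr hg⟩
  · have h0 : g i / f i ≠ 0 := fun h0 => by simp [h0] at hr; linarith
    refine ⟨(g i / f i)⁻¹, ?_, Or.inl fun j => ?_⟩
    · rw [abs_inv]
      exact inv_le_one_of_one_le₀ hr.le
    · rw [hg j, inv_mul_cancel_left₀ h0]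

end General

noncomputable section

/-! ### Elements of order 2 in the circle, and the sign -/

namespace Torus

/-- The number `-1`, the element of order `2` of the circle group. -/
def negOne : Torus := Additive.ofMul (-1 : Circle)

theorem add_self_eq_zero {w : Torus} (h : w + w = 0) : w = 0 ∨ w = negOne := by
  have h1 : w.toMul * w.toMul = 1 := congrArg Additive.toMul h
  have h2 : (w.toMul : ℂ) * w.toMul = 1 := by rw [← Circle.coe_mul, h1, Circle.coe_one]
  rcases mul_self_eq_one_iff.1 h2 with h3 | h3
  · exact Or.inl (congrArg Additive.ofMul (Circle.ext h3 : w.toMul = 1))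
  · exact Or.inr (congrArg Additive.ofMul (Circle.ext (by simpa using h3) : w.toMul = -1))

theorem negOne_add_self : negOne + negOne = 0 := by
  change Additive.ofMul ((-1 : Circle) * -1) = 0
  rw [neg_mul_neg, one_mul, ofMul_one]

theorem negOne_ne_zero : negOne ≠ 0 := fun h => by
  have h1 : (-1 : Circle) = 1 := congrArg Additive.toMul h
  have h2 := congrArg (fun z : Circle => (z : ℂ)) h1
  norm_num at h2

theorem exists_add_self (d : Torus) : ∃ c, c + c = d := by
  refine ⟨Additive.ofMul (Circle.exp (Complex.arg d.toMul / 2)), ?_⟩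
  rw [← ofMul_mul, ← Circle.exp_add, add_halves, Circle.exp_arg, ofMul_toMul]

open Classical in
/-- The function equal to `1` at the neutral element and to `-1` elsewhere. -/
def sgn (w : Torus) : ℝ := if w = 0 then 1 else -1

theorem sgn_zero : sgn 0 = 1 := if_pos rfl

theorem sgn_negOne : sgn negOne = -1 := if_neg negOne_ne_zero

theorem measurable_sgn : Measurable sgn :=
  Measurable.ite (MeasurableSet.singleton 0) measurable_const measurable_const

theorem norm_sgn_le (w : Torus) : ‖sgn w‖ ≤ 1 := by
  unfold sgn
  split_ifs <;> simp

theorem sgn_add {w w' : Torus} (h : w = 0 ∨ w = negOne) (h' : w' = 0 ∨ w' = negOne) :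
    sgn (w + w') = sgn w * sgn w' := by
  rcases h with rfl | rfl <;> rcases h' with rfl | rfl <;>
    simp [sgn_zero, sgn_negOne, negOne_add_self]

end Torus

open Torus

variable {a : ℕ → ℕ}

/-- Needed to recover two elements from their sum and difference. -/
theorem Solenoid.eq_of_add_self_eq (h : ∀ g : Solenoid a, addOrderOf g ≠ 2) {g g' : Solenoid a}
    (hg : g + g = g' + g') : g = g' := by
  by_contra hne
  refine h (g - g') (addOrderOf_eq_prime ?_ (sub_ne_zero.2 hne))
  rw [two_nsmul, sub_add_sub_comm, hg, sub_self]

theorem integrable_indicator_fst {μ : Measure (Solenoid a × Torus)} [IsFiniteMeasure μ]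
    {A : Set (Solenoid a)} (hA : MeasurableSet A) :
    Integrable (fun x => A.indicator (1 : Solenoid a → ℝ) x.1) μ := by
  refine Integrable.of_bound
    ((measurable_one.indicator hA).comp measurable_fst).aestronglyMeasurable 1 (.of_forall fun x => ?_)
  by_cases hx : x.1 ∈ A <;> simp [hx]

theorem negOne_mem_subgroupG :
    ((0, negOne) : Solenoid a × Torus) ∈ subgroupG (Solenoid a × Torus) := by
  refine AddSubgroup.subset_closure (addOrderOf_eq_prime ?_ ?_)
  · rw [two_nsmul, Prod.mk_add_mk, negOne_add_self, add_zero, Prod.mk_zero_zero]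
  · exact fun h => negOne_ne_zero (congrArg Prod.snd h)

variable [∀ i, (a i).AtLeastTwo]

/-- If `b/2 = m / (a₀ ⋯ aₙ)`, then `b` has numerator `2m` over the same denominator, so both
characters can be evaluated with one integer representative `j`. -/
theorem Solenoid.char_half_add_self (h : ∀ g : Solenoid a, addOrderOf g ≠ 2) (b : groupH a)
    (g : Solenoid a) : char (half h b) g + char (half h b) g = char b g := by
  obtain ⟨p, rfl⟩ := mk_surjective a g
  obtain ⟨n, m, hm⟩ := half_mem h b
  obtain ⟨t, x⟩ := p
  obtain ⟨j, hj⟩ := exists_int_rep a x n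
  have hb : (b : ℝ) = (2 * m : ℤ) / prodA a n := by
    push_cast
    rw [mul_div_assoc, ← hm]
    ring
  rw [char_mk (half h b) n m hm, char_mk b n _ hb, preChar_apply a n _ t x j (hj n le_rfl),
    preChar_apply a n _ t x j (hj n le_rfl), ← ofMul_mul, ← Circle.exp_add]
  congr 2
  push_cast
  ring

/-! ### The fibre character and the subgroup `K` -/

/-- The homomorphism `(g, z) ↦ (g, c) z` from `Σ_a × 𝕋` to `𝕋`. -/
def fiberChar (c : groupH a) : Solenoid a × Torus →+ Torus :=
  (Solenoid.char c).toAddMonoidHom.coprod (AddMonoidHom.id Torus)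

theorem fiberChar_apply (c : groupH a) (x : Solenoid a × Torus) :
    fiberChar c x = Solenoid.char c x.1 + x.2 := rfl

theorem measurable_char (c : groupH a) : Measurable (Solenoid.char c) :=
  (Solenoid.char c).continuous_toFun.measurable

theorem measurable_fiberChar (c : groupH a) : Measurable (fiberChar c) :=
  ((measurable_char c).comp measurable_fst).add measurable_snd

theorem measurable_alpha (b : groupH a) : Measurable (alpha b) :=
  (alpha b).continuous_toFun.measurable

/-- `-(g, b/2) + (g, b) = (g, b/2)`: the off-diagonal entry of `α` compensates the change of sign of
`g`. -/
theorem fiberChar_alpha (h : ∀ g : Solenoid a, addOrderOf g ≠ 2) (b : groupH a)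
    (x : Solenoid a × Torus) :
    fiberChar (Solenoid.half h b) (alpha b x) = fiberChar (Solenoid.half h b) x := by
  change Solenoid.char (Solenoid.half h b) (-x.1) + (Solenoid.char b x.1 + x.2) =
    Solenoid.char (Solenoid.half h b) x.1 + x.2
  rw [← Solenoid.char_half_add_self h b, map_neg]
  abel

theorem mem_subgroupK_iff (c : groupH a) (x : Solenoid a × Torus) :
    x ∈ subgroupK c ↔ fiberChar c x = 0 ∨ fiberChar c x = negOne := by
  have h1 : x ∈ subgroupK c ↔ ∃ g : Solenoid a, x = (g, Solenoid.char c (-g)) ∨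
    x = (g, Additive.ofMul (-(Solenoid.char c (-g)).toMul)) := Iff.rfl
  have h2 : ∀ w : Torus, Additive.ofMul (-w.toMul) = w + negOne := fun w => by
    change Additive.ofMul (-w.toMul) = Additive.ofMul (w.toMul * -1)
    rw [mul_neg, mul_one]
  obtain ⟨g, z⟩ := x
  simp only [h1, h2, Prod.mk.injEq, fiberChar_apply, map_neg]
  constructor
  · rintro ⟨_, ⟨rfl, rfl⟩ | ⟨rfl, rfl⟩⟩
    · exact Or.inl (add_neg_cancel _)
    · exact Or.inr (add_neg_cancel_left _ _)
  · rintro (h | h)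
    · exact ⟨g, Or.inl ⟨rfl, (neg_eq_of_add_eq_zero_right h).symm⟩⟩
    · exact ⟨g, Or.inr ⟨rfl, by rw [← h, neg_add_cancel_left]⟩⟩

theorem measurableSet_subgroupK (c : groupH a) :
    MeasurableSet (subgroupK c : Set (Solenoid a × Torus)) := by
  have : (subgroupK c : Set (Solenoid a × Torus)) = fiberChar c ⁻¹' {0, negOne} := by
    ext x
    simp [mem_subgroupK_iff]
  rw [this]
  exact measurable_fiberChar c ((Set.toFinite _).measurableSet)

/-- The section `g ↦ (g, w (g, c)⁻¹)` of the projection `Σ_a × 𝕋 → Σ_a`. -/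
def fiberSection (c : groupH a) (w : Torus) (g : Solenoid a) : Solenoid a × Torus :=
  (g, -Solenoid.char c g + w)

theorem measurable_fiberSection (c : groupH a) (w : Torus) : Measurable (fiberSection c w) :=
  measurable_id.prodMk ((measurable_char c).neg.add_const w)

theorem fiberSection_fiberChar (c : groupH a) (x : Solenoid a × Torus) :
    fiberSection c (fiberChar c x) x.1 = x := by
  ext1
  · rfl
  · exact neg_add_cancel_left _ _

theorem fiberSection_add (c : groupH a) (w w' : Torus) (g : Solenoid a) :
    fiberSection c w g + (0, w') = fiberSection c (w + w') g := by
  ext1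
  · exact add_zero _
  · exact add_assoc _ _ _

/-! ### Distributions concentrated at `K` -/

theorem ae_fiberChar_of_mem_distributionsOn {c : groupH a} {μ : Measure (Solenoid a × Torus)}
    (hμ : μ ∈ distributionsOn (subgroupK c : Set (Solenoid a × Torus))) :
    ∀ᵐ x ∂μ, fiberChar c x = 0 ∨ fiberChar c x = negOne := by
  filter_upwards [mem_ae_iff.2 hμ.2] with x hx
  exact (mem_subgroupK_iff c x).1 hx

theorem integrable_sgn_mul_indicator_fst (c : groupH a) {μ : Measure (Solenoid a × Torus)}
    [IsFiniteMeasure μ] {A : Set (Solenoid a)} (hA : MeasurableSet A) :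
    Integrable (fun x => sgn (fiberChar c x) * A.indicator (1 : Solenoid a → ℝ) x.1) μ :=
  (integrable_indicator_fst hA).bdd_mul
    (measurable_sgn.comp (measurable_fiberChar c)).aestronglyMeasurable
    (.of_forall fun _ => norm_sgn_le _)

/-- A distribution on `K` is determined by its projection to `Σ_a` and by the signed measure
on `Σ_a` obtained by weighting it with the sign. -/
theorem measureReal_eq_of_mem_distributionsOn {c : groupH a} {μ : Measure (Solenoid a × Torus)}
    (hμ : μ ∈ distributionsOn (subgroupK c : Set (Solenoid a × Torus)))
    {E : Set (Solenoid a × Torus)} (hE : MeasurableSet E) :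
    μ.real E =
      ((∫ x, (fiberSection c 0 ⁻¹' E).indicator (1 : Solenoid a → ℝ) x.1 ∂μ) +
        (∫ x, sgn (fiberChar c x) *
          (fiberSection c 0 ⁻¹' E).indicator (1 : Solenoid a → ℝ) x.1 ∂μ) +
        ((∫ x, (fiberSection c negOne ⁻¹' E).indicator (1 : Solenoid a → ℝ) x.1 ∂μ) -
        (∫ x, sgn (fiberChar c x) *
          (fiberSection c negOne ⁻¹' E).indicator (1 : Solenoid a → ℝ) x.1 ∂μ))) / 2 := by
  have := hμ.1
  have h0 := measurable_fiberSection c 0 hE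
  have h1 := measurable_fiberSection c negOne hE
  rw [← integral_add (integrable_indicator_fst h0) (integrable_sgn_mul_indicator_fst c h0),
    ← integral_sub (integrable_indicator_fst h1) (integrable_sgn_mul_indicator_fst c h1),
    ← integral_add, ← integral_div, ← integral_indicator_one hE]
  -- On `K` the weights `(1 + s)/2` and `(1 - s)/2`, with `s` the sign, are the indicators of the
  -- two sheets.
  · refine integral_congr_ae ?_
    filter_upwards [ae_fiberChar_of_mem_distributionsOn hμ] with x hx
    have h2 := fiberSection_fiberChar c x
    have h3 : ∀ w, (fiberSection c w ⁻¹' E).indicator (1 : Solenoid a → ℝ) x.1 =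
      E.indicator 1 (fiberSection c w x.1) := fun w => rfl
    rw [h3, h3]
    rcases hx with hx | hx <;> rw [hx] at h2 ⊢ <;> rw [h2]
    · rw [sgn_zero]; ring
    · rw [sgn_negOne]; ring
  · exact (integrable_indicator_fst h0).add (integrable_sgn_mul_indicator_fst c h0)
  · exact (integrable_indicator_fst h1).sub (integrable_sgn_mul_indicator_fst c h1)

/-- Convolving with a law on `{0, (0, -1)}` keeps the projection to `Σ_a` and multiplies the signed
measure by the mean sign; these two data determine a distribution on `K`. -/
theorem exists_eq_conv {c : groupH a} {μ ν : Measure (Solenoid a × Torus)}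
    (hμ : μ ∈ distributionsOn (subgroupK c : Set (Solenoid a × Torus)))
    (hν : ν ∈ distributionsOn (subgroupK c : Set (Solenoid a × Torus)))
    (h : ∀ A, MeasurableSet A → ∫ x, A.indicator (1 : Solenoid a → ℝ) x.1 ∂μ =
      ∫ x, A.indicator (1 : Solenoid a → ℝ) x.1 ∂ν)
    {t : ℝ} (ht : |t| ≤ 1)
    (hs : ∀ A, MeasurableSet A →
      ∫ x, sgn (fiberChar c x) * A.indicator (1 : Solenoid a → ℝ) x.1 ∂μ =
      t * ∫ x, sgn (fiberChar c x) * A.indicator (1 : Solenoid a → ℝ) x.1 ∂ν) :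
    ∃ ω ∈ distributionsOn (subgroupG (Solenoid a × Torus) : Set (Solenoid a × Torus)),
      μ = ν.conv ω := by
  have := hμ.1
  have := hν.1
  obtain ⟨ht1, ht2⟩ := abs_le.1 ht
  have hp : 0 ≤ (1 + t) / 2 := by linarith
  have hq : 0 ≤ (1 - t) / 2 := by linarith
  -- The masses have sum `1` and difference `t`; `|t| ≤ 1` makes them nonnegative.
  refine ⟨ENNReal.ofReal ((1 + t) / 2) • Measure.dirac 0 +
    ENNReal.ofReal ((1 - t) / 2) • Measure.dirac (0, negOne), ⟨⟨?_⟩, ?_⟩, ?_⟩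
  · simp only [Measure.add_apply, Measure.smul_apply, measure_univ, smul_eq_mul, mul_one]
    rw [← ENNReal.ofReal_add hp hq, ← ENNReal.ofReal_one]
    congr 1
    ring
  · have h1 : ∀ x ∈ subgroupG (Solenoid a × Torus),
        Measure.dirac x (subgroupG (Solenoid a × Torus) : Set (Solenoid a × Torus))ᶜ = 0 :=
      fun x hx => by
        simp [Measure.dirac_apply, hx]
    simp only [Measure.add_apply, Measure.smul_apply, h1 _ (zero_mem _),
      h1 _ negOne_mem_subgroupG, smul_zero, add_zero]
  · rw [Measure.conv_add, Measure.conv_smul_right, Measure.conv_smul_right, Measure.conv_dirac_zero,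
      Measure.conv_dirac]
    have hτ : Measurable fun x : Solenoid a × Torus => x + (0, negOne) := measurable_add_const _
    ext E hE
    rw [← ENNReal.toReal_eq_toReal_iff' (measure_ne_top _ _)]
    · rw [Measure.add_apply, Measure.smul_apply, Measure.smul_apply, Measure.map_apply hτ hE,
        smul_eq_mul, smul_eq_mul, ENNReal.toReal_add
          (ENNReal.mul_ne_top ENNReal.ofReal_ne_top (measure_ne_top _ _))
          (ENNReal.mul_ne_top ENNReal.ofReal_ne_top (measure_ne_top _ _)),
        ENNReal.toReal_mul, ENNReal.toReal_mul, ENNReal.toReal_ofReal hp, ENNReal.toReal_ofReal hq]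
      change μ.real E = _ * ν.real E + _ * ν.real _
      -- Translation by `(0, -1)` interchanges the two sheets of `K`.
      have e1 : fiberSection c 0 ⁻¹' ((fun x : Solenoid a × Torus => x + (0, negOne)) ⁻¹' E) =
          fiberSection c negOne ⁻¹' E := by
        ext g
        rw [Set.mem_preimage, Set.mem_preimage, fiberSection_add, zero_add, Set.mem_preimage]
      have e2 : fiberSection c negOne ⁻¹' ((fun x : Solenoid a × Torus => x + (0, negOne)) ⁻¹' E) =
          fiberSection c 0 ⁻¹' E := by
        ext g
        rw [Set.mem_preimage, Set.mem_preimage, fiberSection_add, negOne_add_self, Set.mem_preimage]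
      rw [measureReal_eq_of_mem_distributionsOn hμ hE, measureReal_eq_of_mem_distributionsOn hν hE,
        measureReal_eq_of_mem_distributionsOn hν (hτ hE), e1, e2,
        h _ (measurable_fiberSection c 0 hE), h _ (measurable_fiberSection c negOne hE),
        hs _ (measurable_fiberSection c 0 hE), hs _ (measurable_fiberSection c negOne hE)]
      ring
    · rw [Measure.add_apply, Measure.smul_apply, Measure.smul_apply]
      exact ENNReal.add_ne_top.2 ⟨ENNReal.mul_ne_top ENNReal.ofReal_ne_top (measure_ne_top _ _),
        ENNReal.mul_ne_top ENNReal.ofReal_ne_top (measure_ne_top _ _)⟩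

/-! ### Consequences of the symmetry of the joint law -/

variable {Ω : Type*} [MeasurableSpace Ω] {P : Measure Ω}

/-- The fibre component of `L₁` has order at most `2`. -/
theorem ae_fiberChar_add_self_eq_zero (h : ∀ g : Solenoid a, addOrderOf g ≠ 2) (b : groupH a)
    {ξ₁ ξ₂ : Ω → Solenoid a × Torus} (h₁ : Measurable ξ₁) (h₂ : Measurable ξ₂)
    (hL : P.map (fun ω => (ξ₁ ω + ξ₂ ω, -(ξ₁ ω + alpha b (ξ₂ ω)))) =
      P.map (fun ω => (ξ₁ ω + ξ₂ ω, ξ₁ ω + alpha b (ξ₂ ω)))) :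
    ∀ᵐ ω ∂P, fiberChar (Solenoid.half h b) (ξ₁ ω + ξ₁ ω) +
      fiberChar (Solenoid.half h b) (ξ₂ ω + ξ₂ ω) = 0 := by
  set ψ := fiberChar (Solenoid.half h b) with hψ_def
  have hψ : Measurable ψ := measurable_fiberChar _
  have hα : Measurable (alpha b) := measurable_alpha b
  have hm : MeasurableSet {p : (Solenoid a × Torus) × (Solenoid a × Torus) | ψ p.1 = ψ p.2} :=
    measurableSet_eq_fun (hψ.comp measurable_fst) (hψ.comp measurable_snd)
  have h3 : ∀ᵐ p ∂P.map (fun ω => (ξ₁ ω + ξ₂ ω, ξ₁ ω + alpha b (ξ₂ ω))), ψ p.1 = ψ p.2 := by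
    rw [ae_map_iff (by fun_prop) hm]
    refine .of_forall fun ω => ?_
    rw [map_add, map_add, hψ_def, fiberChar_alpha]
  -- The identity `ψ(L₁) = ψ(L₂)` is an event for the joint law, so it survives replacing `L₂` by
  -- `-L₂`.
  rw [← hL, ae_map_iff (by fun_prop) hm] at h3
  filter_upwards [h3] with ω hω
  rw [map_neg, map_add ψ (ξ₁ ω) (alpha b (ξ₂ ω)), hψ_def, fiberChar_alpha, ← map_add,
    ← hψ_def, eq_neg_iff_add_eq_zero] at hω
  rw [← hω]
  simp only [map_add]
  abel

/-- Exchangeability of the projections to `Σ_a`, jointly with the product of the fibre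
components. -/
theorem map_exchange (h : ∀ g : Solenoid a, addOrderOf g ≠ 2) (b : groupH a)
    {η₁ η₂ : Ω → Solenoid a × Torus} (h₁ : Measurable η₁) (h₂ : Measurable η₂)
    (hL : P.map (fun ω => (η₁ ω + η₂ ω, -(η₁ ω + alpha b (η₂ ω)))) =
      P.map (fun ω => (η₁ ω + η₂ ω, η₁ ω + alpha b (η₂ ω)))) :
    P.map (fun ω => ((η₁ ω).1, (η₂ ω).1, fiberChar (Solenoid.half h b) (η₁ ω + η₂ ω))) =
      P.map (fun ω => ((η₂ ω).1, (η₁ ω).1, fiberChar (Solenoid.half h b) (η₁ ω + η₂ ω))) := by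
  set ψ := fiberChar (Solenoid.half h b)
  have hψ : Measurable ψ := measurable_fiberChar _
  let Θ : Solenoid a × Solenoid a × Torus → Solenoid a × Solenoid a × Torus :=
    fun p => (p.1 + p.2.1, p.1 - p.2.1, p.2.2)
  have hΘc : Continuous Θ := by fun_prop
  have hΘi : Function.Injective Θ := by
    rintro ⟨g, k, w⟩ ⟨g', k', w'⟩ he
    simp only [Θ, Prod.mk.injEq] at he
    obtain ⟨e1, e2, rfl⟩ := he
    have e3 : g = g' := Solenoid.eq_of_add_self_eq h (by
      rw [show g + g = (g + k) + (g - k) by abel, e1, e2]; abel)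
    subst e3
    rw [add_left_cancel e1]
  -- A continuous injection of Polish spaces is a measurable embedding, so two laws agree once their
  -- images under `Θ` do.
  have hΘ : MeasurableEmbedding Θ := hΘc.measurableEmbedding hΘi
  -- `ψ` is read off `L₁`, which the symmetry leaves alone; of `L₂` only the projection, the
  -- difference, is kept.
  let F : (Solenoid a × Torus) × (Solenoid a × Torus) → Solenoid a × Solenoid a × Torus :=
    fun p => (p.1.1, p.2.1, ψ p.1)
  have hF : Measurable F := by fun_prop
  have hα : Measurable (alpha b) := measurable_alpha b
  have h3 := congrArg (Measure.map F) hL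
  rw [Measure.map_map hF (by fun_prop), Measure.map_map hF (by fun_prop)] at h3
  have h4 : Measure.map Θ (P.map (fun ω => ((η₁ ω).1, (η₂ ω).1, ψ (η₁ ω + η₂ ω)))) =
      Measure.map Θ (P.map (fun ω => ((η₂ ω).1, (η₁ ω).1, ψ (η₁ ω + η₂ ω)))) := by
    rw [Measure.map_map hΘ.measurable (by fun_prop), Measure.map_map hΘ.measurable (by fun_prop)]
    convert h3.symm using 2
    · funext ω
      simp only [Function.comp_apply, Θ, F, Prod.mk.injEq]
      exact ⟨rfl, sub_eq_add_neg _ _, trivial⟩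
    · funext ω
      simp only [Function.comp_apply, Θ, F, Prod.mk.injEq]
      refine ⟨add_comm _ _, ?_, trivial⟩
      change (η₂ ω).1 - (η₁ ω).1 = -((η₁ ω).1 + -(η₂ ω).1)
      abel
  rw [← hΘ.comap_map (P.map fun ω => ((η₁ ω).1, (η₂ ω).1, ψ (η₁ ω + η₂ ω))), h4, hΘ.comap_map]

/-- Exchangeability equates the projections and, by independence, makes the two signed measures
proportional. -/
theorem exists_conv_of_exchange {c : groupH a} {η₁ η₂ : Ω → Solenoid a × Torus}
    (h₁ : Measurable η₁) (h₂ : Measurable η₂) (hindep : IndepFun η₁ η₂ P)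
    (hK₁ : P.map η₁ ∈ distributionsOn (subgroupK c : Set (Solenoid a × Torus)))
    (hK₂ : P.map η₂ ∈ distributionsOn (subgroupK c : Set (Solenoid a × Torus)))
    (hex : P.map (fun ω => ((η₁ ω).1, (η₂ ω).1, fiberChar c (η₁ ω + η₂ ω))) =
      P.map (fun ω => ((η₂ ω).1, (η₁ ω).1, fiberChar c (η₁ ω + η₂ ω)))) :
    (∃ ω₁ ∈ distributionsOn (subgroupG (Solenoid a × Torus) : Set (Solenoid a × Torus)),
      P.map η₂ = (P.map η₁).conv ω₁) ∨
    (∃ ω₂ ∈ distributionsOn (subgroupG (Solenoid a × Torus) : Set (Solenoid a × Torus)),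
      P.map η₁ = (P.map η₂).conv ω₂) := by
  have hψ : Measurable (fiberChar c) := measurable_fiberChar c
  have hint : ∀ f : Solenoid a × Solenoid a × Torus → ℝ, Measurable f →
      ∫ ω, f ((η₁ ω).1, (η₂ ω).1, fiberChar c (η₁ ω + η₂ ω)) ∂P =
      ∫ ω, f ((η₂ ω).1, (η₁ ω).1, fiberChar c (η₁ ω + η₂ ω)) ∂P := fun f hf => by
    rw [← integral_map (φ := fun ω => ((η₁ ω).1, (η₂ ω).1, fiberChar c (η₁ ω + η₂ ω)))
      (Measurable.aemeasurable (by fun_prop)) hf.aestronglyMeasurable, hex,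
      integral_map (Measurable.aemeasurable (by fun_prop)) hf.aestronglyMeasurable]
  have hM : ∀ A, MeasurableSet A → ∫ x, A.indicator (1 : Solenoid a → ℝ) x.1 ∂(P.map η₁) =
      ∫ x, A.indicator (1 : Solenoid a → ℝ) x.1 ∂(P.map η₂) := fun A hA => by
    have hm := (measurable_one (α := ℝ)).indicator hA
    have hm' : Measurable fun x : Solenoid a × Torus => A.indicator (1 : Solenoid a → ℝ) x.1 :=
      hm.comp measurable_fst
    rw [integral_map h₁.aemeasurable hm'.aestronglyMeasurable,
      integral_map h₂.aemeasurable hm'.aestronglyMeasurable]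
    exact hint (fun p => A.indicator 1 p.1) (hm.comp measurable_fst)
  let w : Set (Solenoid a) → Solenoid a × Torus → ℝ :=
    fun A x => sgn (fiberChar c x) * A.indicator (1 : Solenoid a → ℝ) x.1
  have hw : ∀ A, MeasurableSet A → Measurable (w A) := fun A hA =>
    (measurable_sgn.comp hψ).mul ((measurable_one.indicator hA).comp measurable_fst)
  have hprod : ∀ A B, MeasurableSet A → MeasurableSet B →
      ∫ ω, w A (η₁ ω) * w B (η₂ ω) ∂P = (∫ x, w A x ∂P.map η₁) * ∫ x, w B x ∂P.map η₂ :=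
    fun A B hA hB => by
      rw [integral_map h₁.aemeasurable (hw A hA).aestronglyMeasurable,
        integral_map h₂.aemeasurable (hw B hB).aestronglyMeasurable]
      exact (hindep.comp (hw A hA) (hw B hB)).integral_fun_mul_eq_mul_integral
        ((hw A hA).comp h₁).aestronglyMeasurable ((hw B hB).comp h₂).aestronglyMeasurable
  have hN : ∀ A B : {A : Set (Solenoid a) // MeasurableSet A},
      (∫ x, w A x ∂P.map η₁) * ∫ x, w B x ∂P.map η₂ =
      (∫ x, w B x ∂P.map η₁) * ∫ x, w A x ∂P.map η₂ := fun ⟨A, hA⟩ ⟨B, hB⟩ => by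
    rw [← hprod A B hA hB, ← hprod B A hB hA]
    -- On `K` the sign of `ψ(η₁ + η₂)` is the product of the two signs, so this test function splits
    -- into one factor for each variable.
    have hf := hint (fun p => sgn p.2.2 * (A.indicator 1 p.1 * B.indicator 1 p.2.1)) (by
      have hA' := (measurable_one (α := ℝ)).indicator hA
      have hB' := (measurable_one (α := ℝ)).indicator hB
      have hs := measurable_sgn
      fun_prop)
    refine Eq.trans (integral_congr_ae ?_) (hf.trans (integral_congr_ae ?_))
    all_goals
      filter_upwards [ae_of_ae_map h₁.aemeasurable (ae_fiberChar_of_mem_distributionsOn hK₁),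
        ae_of_ae_map h₂.aemeasurable (ae_fiberChar_of_mem_distributionsOn hK₂)] with ω e1 e2
      simp only [w, map_add, sgn_add e1 e2]
      ring
  obtain ⟨t, ht, h3 | h3⟩ := exists_proportional _ _ hN
  · exact Or.inr (exists_eq_conv hK₁ hK₂ hM ht fun A hA => h3 ⟨A, hA⟩)
  · exact Or.inl (exists_eq_conv hK₂ hK₁ (fun A hA => (hM A hA).symm) ht fun A hA => h3 ⟨A, hA⟩)

/-- `ψ` is the identity on the circle factor, so after the shift its double vanishes and its value
is `±1`. -/
theorem map_sub_mem_distributionsOn [IsProbabilityMeasure P] {c : groupH a} {ξ : Ω → Solenoid a × Torus}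
    (hξ : Measurable ξ) {d : Torus} (h : ∀ᵐ ω ∂P, fiberChar c (ξ ω + ξ ω) = d + d) :
    P.map (fun ω => ξ ω - (0, d)) ∈
      distributionsOn (subgroupK c : Set (Solenoid a × Torus)) := by
  have hm : Measurable fun ω => ξ ω - ((0, d) : Solenoid a × Torus) := hξ.sub_const _
  refine ⟨Measure.isProbabilityMeasure_map hm.aemeasurable, ?_⟩
  rw [← mem_ae_iff]
  refine (ae_map_iff hm.aemeasurable (measurableSet_subgroupK c)).2 ?_
  filter_upwards [h] with ω hω
  refine (mem_subgroupK_iff c _).2 (add_self_eq_zero ?_)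
  have hd : fiberChar c ((0, d) : Solenoid a × Torus) = d := by simp [fiberChar_apply]
  rw [map_sub, hd, sub_add_sub_comm, ← map_add, hω, sub_self]

end

end Heyde

/-! ### Centring and conclusion -/

theorem proposition4p1 (a : ℕ → ℕ) [∀ i, (a i).AtLeastTwo]
    (h2 : ∀ g : Solenoid a, addOrderOf g ≠ 2) (b : groupH a)
    {Ω : Type*} [MeasurableSpace Ω] (P : Measure Ω) [IsProbabilityMeasure P]
    (ξ₁ ξ₂ : Ω → Solenoid a × Torus) (hξ₁ : Measurable ξ₁) (hξ₂ : Measurable ξ₂)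
    (hindep : IndepFun ξ₁ ξ₂ P)
    (hsymm : CondSymmetric P (fun ω => ξ₁ ω + alpha b (ξ₂ ω)) (fun ω => ξ₁ ω + ξ₂ ω)) :
    ∃ lam₁ ∈ distributionsOn (subgroupK (Solenoid.half h2 b) : Set (Solenoid a × Torus)),
    ∃ lam₂ ∈ distributionsOn (subgroupK (Solenoid.half h2 b) : Set (Solenoid a × Torus)),
    ∃ x₁ x₂ : Solenoid a × Torus,
      P.map ξ₁ = lam₁.conv (Measure.dirac x₁) ∧ P.map ξ₂ = lam₂.conv (Measure.dirac x₂) ∧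
      ((∃ ω₁ ∈ distributionsOn (subgroupG (Solenoid a × Torus) : Set (Solenoid a × Torus)),
          lam₂ = lam₁.conv ω₁) ∨
        (∃ ω₂ ∈ distributionsOn (subgroupG (Solenoid a × Torus) : Set (Solenoid a × Torus)),
          lam₁ = lam₂.conv ω₂)) := by
  have hα : Measurable (alpha b) := measurable_alpha b
  have hL := hsymm.map_prodMk_neg (by fun_prop) (by fun_prop)
  have hdbl : Measurable fun x : Solenoid a × Torus =>
      fiberChar (Solenoid.half h2 b) (x + x) :=
    (measurable_fiberChar _).comp (measurable_id.add measurable_id)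
  obtain ⟨e, he₁, he₂⟩ := exists_ae_eq_of_indepFun_of_add_eq_zero (hdbl.comp hξ₁) (hdbl.comp hξ₂)
    (hindep.comp hdbl hdbl) (ae_fiberChar_add_self_eq_zero h2 b hξ₁ hξ₂ hL)
  -- The shifts `(0, d)` and `(0, -d)` cancel in `L₁`, and also in `L₂` because `α` fixes the circle
  -- factor.
  obtain ⟨d, rfl⟩ := Torus.exists_add_self e
  rw [neg_add] at he₂
  have hK₁ := map_sub_mem_distributionsOn hξ₁ he₁
  have hK₂ := map_sub_mem_distributionsOn hξ₂ he₂
  set x₁ : Solenoid a × Torus := (0, d) with hx₁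
  set x₂ : Solenoid a × Torus := (0, -d) with hx₂
  have hη₁ : Measurable fun ω => ξ₁ ω - x₁ := hξ₁.sub_const _
  have hη₂ : Measurable fun ω => ξ₂ ω - x₂ := hξ₂.sub_const _
  have hshift : ∀ {ξ : Ω → Solenoid a × Torus} (x : Solenoid a × Torus), Measurable ξ →
      P.map ξ = (P.map fun ω => ξ ω - x).conv (Measure.dirac x) := fun {ξ} x hξ => by
    rw [Measure.conv_dirac, Measure.map_map (measurable_add_const x) (hξ.sub_const x)]
    congr 1
    funext ω
    simp
  have hx : x₁ + x₂ = 0 := by simp [hx₁, hx₂]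
  have hαx : alpha b x₂ = x₂ := by
    change (-(0 : Solenoid a), Solenoid.char b 0 + -d) = _
    rw [neg_zero, map_zero, zero_add]
  have e1 : ∀ ω, ξ₁ ω - x₁ + (ξ₂ ω - x₂) = ξ₁ ω + ξ₂ ω := fun ω => by
    rw [sub_add_sub_comm, hx, sub_zero]
  have e2 : ∀ ω, ξ₁ ω - x₁ + alpha b (ξ₂ ω - x₂) = ξ₁ ω + alpha b (ξ₂ ω) := fun ω => by
    rw [map_sub, hαx, sub_add_sub_comm, hx, sub_zero]
  refine ⟨_, hK₁, _, hK₂, x₁, x₂, hshift x₁ hξ₁, hshift x₂ hξ₂, ?_⟩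
  refine exists_conv_of_exchange hη₁ hη₂
    (hindep.comp (measurable_sub_const x₁) (measurable_sub_const x₂)) hK₁ hK₂
    (map_exchange h2 b hη₁ hη₂ ?_)
  simpa only [e1, e2] using hL
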